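/- Fix a first-order alphabet with at least one constant. A program $P$ is a finite set of predicate definitions $(p(V_1,\dots,V_n),\ \exists W[C_1\lor\dots\lor C_k])$, $k>0$, at most one for each predicate symbol $p$ other than the built-in equality $=$; the $V_i$ are distinct variables, the $C_j$ are conjunctions of literals (atoms, equations between terms, and their negations), and $W$ consists of the variables of the body that are not among the $V_i$. Every predicate symbol other than $=$ that occurs in a body of $P$ is assumed to have a definition in $P$. An interpretation $I$ maps ground atoms to $\mathbf 4=\{\mathbf u,\mathbf f,\mathbf t,\mathbf i\}$, where a ground equation $s=t$ gets $\mathbf t$ if $s$ and $t$ are identical and $\mathbf f$ otherwise. $I$ makes a ground atom $A$ true if $I(A)\in\{\mathbf t,\mathbf i\}$ and false if $I(A)\in\{\mathbf f,\mathbf i\}$. Truth and falsity extend to formulas separately: $\neg A$ is made true (false) iff $A$ is made false (true); a conjunction is made true iff all its literals are, and false iff one of them is; a disjunction is made true iff one disjunct is, and false iff all of them are; $\exists W[D]$ is made true iff some ground instance of $D$ is, and false iff all ground instances of $D$ are. The value $I(F)$ of a formula is $\mathbf i$, $\mathbf t$, $\mathbf f$ or $\mathbf u$ according to whether $F$ is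 made both true and false, only true, only false, or neither. The information ordering is $a\sqsubseteq b$ iff $a=\mathbf u$ or $a=b$ or $b=\mathbf i$. $I$ is a $\sqsupseteq^{\mathbf 4}$-model of $P$ if $I(B)\sqsubseteq I(H)$ for every pair $(H,B)$ obtained from a definition in $P$ by replacing the head variables by ground terms. A ground atom succeeds if, as a query to $P$, it has an SLDNF refutation, and it finitely fails if it has a finitely failed SLDNF tree. Here equations are solved by unification, any literal of a goal may be selected except that negative literals may be selected only when they are ground, and a selected ground literal $\neg A$ is removed if $A$ finitely fails and fails if $A$ succeeds. Let $I$ be a $\sqsupseteq^{\mathbf 4}$-model of $P$, and let $A$ be a ground atom that is an equation or whose predicate symbol has a definition in $P$. Then: 1. if $I(A)=\mathbf t$, then $A$ does not finitely fail; 2. if $I(A)=\mathbf f$, then $A$ does not succeed; 3. if $I(A)=\mathbf u$, then $A$ neither succeeds nor finitely fails. -/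

import Mathlib

namespace FourLP

universe u v w w'

/-! ### Syntax of programs

The alphabet is a first-order language `L`: its functions are the function symbols and its
relations are the predicate symbols other than the distinguished equality predicate. -/

/-- Atoms with variables from `α`: `s = t` or `p(t₁, …, tₙ)`. -/
inductive Atom (L : FirstOrder.Language.{u, v}) (α : Type w) : Type (max u v w)
  | eq (s t : L.Term α) : Atom L α
  | rel {n : ℕ} (p : L.Relations n) (args : Fin n → L.Term α) : Atom L α

/-- Literals: an atom or the negation of an atom. -/
inductive Literal (L : FirstOrder.Language.{u, v}) (α : Type w) : Type (max u v w)
  | pos (A : Atom L α) : Literal L α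
  | neg (A : Atom L α) : Literal L α

variable {L : FirstOrder.Language.{u, v}} {α : Type w} {β : Type w'}

/-- Apply a substitution to an atom. -/
def Atom.subst (θ : α → L.Term β) : Atom L α → Atom L β
  | .eq s t => .eq (s.subst θ) (t.subst θ)
  | .rel p args => .rel p (fun i => (args i).subst θ)

/-- Apply a substitution to a literal. -/
def Literal.subst (θ : α → L.Term β) : Literal L α → Literal L β
  | .pos A => .pos (A.subst θ)
  | .neg A => .neg (A.subst θ)

/-- The atom of a literal. -/
def Literal.atom : Literal L α → Atom L α
  | .pos A => A
  | .neg A => A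

/-- The variables that occur in an atom. -/
def Atom.vars : Atom L ℕ → Set ℕ
  | .eq s t => (s.varFinset : Set ℕ) ∪ t.varFinset
  | .rel _ args => ⋃ i, ((args i).varFinset : Set ℕ)

/-- Ground terms: terms without variables. -/
abbrev GroundTerm (L : FirstOrder.Language.{u, v}) := L.Term Empty

/-- Ground atoms. -/
abbrev GroundAtom (L : FirstOrder.Language.{u, v}) := Atom L Empty

/-- A ground atom, read as an atom over the variables. -/
def Atom.ofGround (A : GroundAtom L) : Atom L ℕ := A.subst (fun e => e.elim)

/-- A conjunction of literals. -/
abbrev Conj (L : FirstOrder.Language.{u, v}) := List (Literal L ℕ)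

/-- The data of a definition `(p(V₁, …, Vₙ), ∃ W [C₁ ∨ ⋯ ∨ Cₖ])` of an `n`-ary predicate symbol
`p`: the distinct head variables `Vᵢ` and the list of the conjunctions `C₁, …, Cₖ`, `k > 0`.
All variables that are not head variables are local. -/
structure PredDef (L : FirstOrder.Language.{u, v}) (n : ℕ) where
  headVar : Fin n → ℕ
  headVar_injective : Function.Injective headVar
  body : List (Conj L)
  body_ne_nil : body ≠ []

/-- A program: a finite set of predicate definitions, at most one for each predicate symbol,
given as the partial map from predicate symbols to their definitions. -/
structure Program (L : FirstOrder.Language.{u, v}) where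
  defn : ∀ {n : ℕ}, L.Relations n → Option (PredDef L n)
  finite_defn : {p : Σ n, L.Relations n | (defn p.2).isSome}.Finite

/-- The predicate of `A` is equality, or it has a definition in `P`. -/
def Atom.DefinedIn (P : Program L) : Atom L α → Prop
  | .eq _ _ => True
  | .rel p _ => (P.defn p).isSome

/-- Every predicate symbol other than equality that is called in the body of some definition in
`P` has itself a definition in `P`. -/
def Program.Closed (P : Program L) : Prop :=
  ∀ (n : ℕ) (p : L.Relations n) (d : PredDef L n), P.defn p = some d →
    ∀ C ∈ d.body, ∀ l ∈ C, l.atom.DefinedIn P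

/-! ### Four-valued interpretations and models -/

/-- The four truth values. -/
inductive Truth4 : Type
  | u | f | t | i

/-- The information ordering `⊑` on the four truth values. -/
def Truth4.InfoLE (a b : Truth4) : Prop := a = .u ∨ a = b ∨ b = .i

/-- The converse `⊒` of the information ordering. -/
def Truth4.InfoGE (a b : Truth4) : Prop := b.InfoLE a

open Classical in
/-- The truth value of a formula that is made true iff `T` and made false iff `F`. -/
noncomputable def Truth4.ofProps (T F : Prop) : Truth4 :=
  if T then (if F then .i else .t) else (if F then .f else .u)

/-- Interpretations map ground atoms to truth values; equality is interpreted as identity of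
ground terms. -/
structure Interp (L : FirstOrder.Language.{u, v}) where
  val : GroundAtom L → Truth4
  val_eq_self : ∀ s : GroundTerm L, val (.eq s s) = .t
  val_eq_ne : ∀ s t : GroundTerm L, s ≠ t → val (.eq s t) = .f

namespace Interp

variable (I : Interp L)

/-- `I` makes the ground atom `A` true: `A ∈ T_I`. -/
def AtomTrue (A : GroundAtom L) : Prop := I.val A = .t ∨ I.val A = .i

/-- `I` makes the ground atom `A` false: `A ∈ F_I`. -/
def AtomFalse (A : GroundAtom L) : Prop := I.val A = .f ∨ I.val A = .i

/-- `I` makes a ground literal true. -/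
def LitTrue : Literal L Empty → Prop
  | .pos A => I.AtomTrue A
  | .neg A => I.AtomFalse A

/-- `I` makes a ground literal false. -/
def LitFalse : Literal L Empty → Prop
  | .pos A => I.AtomFalse A
  | .neg A => I.AtomTrue A

/-- `I` makes the instance `C τ` of a conjunction true. -/
def ConjTrue (C : Conj L) (τ : ℕ → GroundTerm L) : Prop := ∀ l ∈ C, I.LitTrue (l.subst τ)

/-- `I` makes the instance `C τ` of a conjunction false. -/
def ConjFalse (C : Conj L) (τ : ℕ → GroundTerm L) : Prop := ∃ l ∈ C, I.LitFalse (l.subst τ)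

/-- `I` makes the instance `D τ` of a disjunction true. -/
def DisjTrue (D : List (Conj L)) (τ : ℕ → GroundTerm L) : Prop := ∃ C ∈ D, I.ConjTrue C τ

/-- `I` makes the instance `D τ` of a disjunction false. -/
def DisjFalse (D : List (Conj L)) (τ : ℕ → GroundTerm L) : Prop := ∀ C ∈ D, I.ConjFalse C τ

/-- `I` makes the body of the head grounding of `d` with head arguments `args` true: it makes
some ground instance of the disjunction true. -/
def BodyTrue {n : ℕ} (d : PredDef L n) (args : Fin n → GroundTerm L) : Prop :=
  ∃ τ : ℕ → GroundTerm L, (∀ k, τ (d.headVar k) = args k) ∧ I.DisjTrue d.body τ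

/-- `I` makes the body of the head grounding of `d` with head arguments `args` false: it makes
all ground instances of the disjunction false. -/
def BodyFalse {n : ℕ} (d : PredDef L n) (args : Fin n → GroundTerm L) : Prop :=
  ∀ τ : ℕ → GroundTerm L, (∀ k, τ (d.headVar k) = args k) → I.DisjFalse d.body τ

/-- The truth value in `I` of the body of the head grounding of `d` with head arguments `args`. -/
noncomputable def bodyVal {n : ℕ} (d : PredDef L n) (args : Fin n → GroundTerm L) : Truth4 :=
  Truth4.ofProps (I.BodyTrue d args) (I.BodyFalse d args)

/-- `I` is an `R`-model of `P`: for every head grounding `(H, B)` of every definition in `P`,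
the values of `H` and `B` in `I` are related by `R`. -/
def IsModel (R : Truth4 → Truth4 → Prop) (P : Program L) : Prop :=
  ∀ (n : ℕ) (p : L.Relations n) (d : PredDef L n), P.defn p = some d →
    ∀ args : Fin n → GroundTerm L, R (I.val (.rel p args)) (I.bodyVal d args)

end Interp

/-! ### SLDNF resolution -/

/-- A goal is a conjunction of literals that remain to be solved. -/
abbrev Goal (L : FirstOrder.Language.{u, v}) := List (Literal L ℕ)

/-- The variables that occur in a goal. -/
def Goal.vars (G : Goal L) : Set ℕ := {x | ∃ l ∈ G, x ∈ l.atom.vars}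

/-- `θ` unifies `s` and `t`. -/
def Unifies (θ : ℕ → L.Term ℕ) (s t : L.Term ℕ) : Prop := s.subst θ = t.subst θ

/-- `θ` is a most general unifier of `s` and `t`: every unifier is an instance of `θ`. -/
def IsMGU (θ : ℕ → L.Term ℕ) (s t : L.Term ℕ) : Prop :=
  Unifies θ s t ∧ ∀ σ, Unifies σ s t → ∃ δ : ℕ → L.Term ℕ, ∀ x, σ x = (θ x).subst δ

/-- `η` produces the head instance of `d` with head arguments `args`, the local variables being
renamed to distinct variables that do not occur in the goal `G`. -/
def IsHeadInstance (G : Goal L) {n : ℕ} (d : PredDef L n) (args : Fin n → L.Term ℕ)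
    (η : ℕ → L.Term ℕ) : Prop :=
  (∀ k, η (d.headVar k) = args k) ∧
  ∃ ρ : ℕ → ℕ, Set.InjOn ρ (Set.range d.headVar)ᶜ ∧
    ∀ x ∉ Set.range d.headVar, ρ x ∉ G.vars ∧ η x = FirstOrder.Language.Term.var (ρ x)

mutual

/-- The goal has an SLDNF refutation. In each step an arbitrary literal of the goal is selected; a
negative literal may be selected only if it is ground. -/
inductive Refutable (P : Program L) : Goal L → Prop
  | nil : Refutable P []
  | eq (G₁ G₂ : Goal L) (s t : L.Term ℕ) (θ : ℕ → L.Term ℕ) (hθ : IsMGU θ s t)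
      (h : Refutable P ((G₁ ++ G₂).map (Literal.subst θ))) :
      Refutable P (G₁ ++ .pos (.eq s t) :: G₂)
  | rel (G₁ G₂ : Goal L) {n : ℕ} (p : L.Relations n) (args : Fin n → L.Term ℕ)
      (d : PredDef L n) (hd : P.defn p = some d) (C : Conj L) (hC : C ∈ d.body)
      (η : ℕ → L.Term ℕ)
      (hη : IsHeadInstance (G₁ ++ .pos (.rel p args) :: G₂) d args η)
      (h : Refutable P (G₁ ++ C.map (Literal.subst η) ++ G₂)) :
      Refutable P (G₁ ++ .pos (.rel p args) :: G₂)
  | neg (G₁ G₂ : Goal L) (A : Atom L ℕ) (hA : A.vars = ∅)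
      (hf : FinitelyFailed P [.pos A]) (h : Refutable P (G₁ ++ G₂)) :
      Refutable P (G₁ ++ .neg A :: G₂)

/-- The goal has a finitely failed SLDNF tree. In each node an arbitrary literal of the goal is
selected; a negative literal may be selected only if it is ground. -/
inductive FinitelyFailed (P : Program L) : Goal L → Prop
  | eq_clash (G₁ G₂ : Goal L) (s t : L.Term ℕ) (hst : ¬ ∃ θ, Unifies θ s t) :
      FinitelyFailed P (G₁ ++ .pos (.eq s t) :: G₂)
  | eq (G₁ G₂ : Goal L) (s t : L.Term ℕ) (θ : ℕ → L.Term ℕ) (hθ : IsMGU θ s t)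
      (h : FinitelyFailed P ((G₁ ++ G₂).map (Literal.subst θ))) :
      FinitelyFailed P (G₁ ++ .pos (.eq s t) :: G₂)
  | rel_undefined (G₁ G₂ : Goal L) {n : ℕ} (p : L.Relations n) (args : Fin n → L.Term ℕ)
      (hd : P.defn p = none) :
      FinitelyFailed P (G₁ ++ .pos (.rel p args) :: G₂)
  | rel (G₁ G₂ : Goal L) {n : ℕ} (p : L.Relations n) (args : Fin n → L.Term ℕ)
      (d : PredDef L n) (hd : P.defn p = some d) (η : ℕ → L.Term ℕ)
      (hη : IsHeadInstance (G₁ ++ .pos (.rel p args) :: G₂) d args η)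
      (h : ∀ C ∈ d.body, FinitelyFailed P (G₁ ++ C.map (Literal.subst η) ++ G₂)) :
      FinitelyFailed P (G₁ ++ .pos (.rel p args) :: G₂)
  | neg_refuted (G₁ G₂ : Goal L) (A : Atom L ℕ) (hA : A.vars = ∅)
      (hs : Refutable P [.pos A]) :
      FinitelyFailed P (G₁ ++ .neg A :: G₂)
  | neg (G₁ G₂ : Goal L) (A : Atom L ℕ) (hA : A.vars = ∅)
      (hf : FinitelyFailed P [.pos A]) (h : FinitelyFailed P (G₁ ++ G₂)) :
      FinitelyFailed P (G₁ ++ .neg A :: G₂)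

end

/-- The ground atom `A` succeeds: the query `A` has an SLDNF refutation. -/
def Succeeds (P : Program L) (A : GroundAtom L) : Prop := Refutable P [.pos A.ofGround]

/-- The ground atom `A` finitely fails: the query `A` has a finitely failed SLDNF tree. -/
def FinitelyFails (P : Program L) (A : GroundAtom L) : Prop := FinitelyFailed P [.pos A.ofGround]

end FourLP

namespace FourLP

universe u v w w' w''

variable {L : FirstOrder.Language.{u, v}} {α : Type w} {β : Type w'} {γ : Type w''}

/-! ### Substitutions -/

-- Truth and falsity are two independent bits of a value, and `⊑` compares them separately. So in a
-- `⊒`-model a true body forces a true head and a false body forces a false head. Soundness of SLDNF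
-- resolution then follows by simultaneous induction on derivations: a refutable goal has a ground
-- instance made true (`Refutable.exists_conjTrue`), and a finitely failed goal has all its ground
-- instances made false (`FinitelyFailed.conjFalse`). The two inductions meet at ground negative
-- literals. Two facts about substitutions carry the failure half: every ground unifier factors
-- through an mgu (`IsMGU.exists_ground`), and fresh local variables can be valued independently of
-- the goal (`IsHeadInstance.exists_ground`). For a ground atom, success thus excludes the values
-- `f` and `u`, and finite failure excludes `t` and `u`.

theorem subst_subst_term (t : L.Term α) (θ : α → L.Term β) (δ : β → L.Term γ) :
    (t.subst θ).subst δ = t.subst (fun x => (θ x).subst δ) := by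
  induction t with
  | var => rfl
  | func f ts ih => simp only [FirstOrder.Language.Term.subst, ih]

theorem subst_congr_term {t : L.Term ℕ} {θ δ : ℕ → L.Term β}
    (h : ∀ x ∈ t.varFinset, θ x = δ x) : t.subst θ = t.subst δ := by
  induction t with
  | var x => exact h x (by simp [FirstOrder.Language.Term.varFinset])
  | func f ts ih =>
    simp only [FirstOrder.Language.Term.subst]
    congr 1
    funext i
    refine ih i fun x hx => h x ?_
    simp only [FirstOrder.Language.Term.varFinset, Finset.mem_biUnion, Finset.mem_univ, true_and]
    exact ⟨i, hx⟩

theorem subst_ground_term (t : GroundTerm L) (θ : Empty → GroundTerm L) : t.subst θ = t := by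
  induction t with
  | var x => exact x.elim
  | func f ts ih => simp only [FirstOrder.Language.Term.subst, ih]

theorem Atom.subst_subst (A : Atom L α) (θ : α → L.Term β) (δ : β → L.Term γ) :
    (A.subst θ).subst δ = A.subst (fun x => (θ x).subst δ) := by
  cases A <;> simp only [Atom.subst, subst_subst_term]

theorem Atom.subst_congr {A : Atom L ℕ} {θ δ : ℕ → L.Term β}
    (h : ∀ x ∈ A.vars, θ x = δ x) : A.subst θ = A.subst δ := by
  cases A with
  | eq s t =>
    simp only [Atom.subst]
    rw [subst_congr_term fun x hx => h x (Or.inl hx), subst_congr_term fun x hx => h x (Or.inr hx)]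
  | rel p args =>
    simp only [Atom.subst]
    congr 1
    funext i
    exact subst_congr_term fun x hx => h x (Set.mem_iUnion.2 ⟨i, hx⟩)

theorem Atom.ofGround_subst (A : GroundAtom L) (τ : ℕ → GroundTerm L) :
    A.ofGround.subst τ = A := by
  rw [Atom.ofGround, Atom.subst_subst]
  cases A <;> simp only [Atom.subst, subst_ground_term]

theorem Literal.subst_subst (l : Literal L α) (θ : α → L.Term β) (δ : β → L.Term γ) :
    (l.subst θ).subst δ = l.subst (fun x => (θ x).subst δ) := by
  cases l <;> simp only [Literal.subst, Atom.subst_subst]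

theorem Literal.subst_congr {l : Literal L ℕ} {θ δ : ℕ → L.Term β}
    (h : ∀ x ∈ l.atom.vars, θ x = δ x) : l.subst θ = l.subst δ := by
  cases l <;> exact congrArg _ (Atom.subst_congr h)

/-! ### Goals all of whose predicates are defined -/

theorem Atom.DefinedIn.subst {P : Program L} {A : Atom L α} (h : A.DefinedIn P)
    (θ : α → L.Term β) : (A.subst θ).DefinedIn P := by
  cases A <;> exact h

theorem Literal.definedIn_subst {P : Program L} {l : Literal L α} (h : l.atom.DefinedIn P)
    (θ : α → L.Term β) : (l.subst θ).atom.DefinedIn P := by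
  cases l <;> exact Atom.DefinedIn.subst h θ

/-- Every predicate called in the goal is equality or has a definition in `P`. -/
def Goal.DefinedIn (P : Program L) (G : Goal L) : Prop := ∀ l ∈ G, l.atom.DefinedIn P

theorem Goal.DefinedIn.map_subst {P : Program L} {G : Goal L} (h : G.DefinedIn P)
    (θ : ℕ → L.Term ℕ) : Goal.DefinedIn P (G.map (Literal.subst θ)) := by
  intro l hl
  obtain ⟨l', hl', rfl⟩ := List.mem_map.1 hl
  exact Literal.definedIn_subst (h l' hl') θ

theorem Goal.definedIn_append {P : Program L} {G₁ G₂ : Goal L} :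
    Goal.DefinedIn P (G₁ ++ G₂) ↔ Goal.DefinedIn P G₁ ∧ Goal.DefinedIn P G₂ :=
  List.forall_mem_append

theorem Goal.definedIn_cons {P : Program L} {l : Literal L ℕ} {G : Goal L} :
    Goal.DefinedIn P (l :: G) ↔ l.atom.DefinedIn P ∧ Goal.DefinedIn P G :=
  List.forall_mem_cons

theorem Goal.DefinedIn.erase {P : Program L} {G₁ G₂ : Goal L} {l : Literal L ℕ}
    (h : Goal.DefinedIn P (G₁ ++ l :: G₂)) : Goal.DefinedIn P (G₁ ++ G₂) := by
  rw [Goal.definedIn_append, Goal.definedIn_cons] at h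
  exact Goal.definedIn_append.2 ⟨h.1, h.2.2⟩

theorem Goal.DefinedIn.selected {P : Program L} {G₁ G₂ : Goal L} {l : Literal L ℕ}
    (h : Goal.DefinedIn P (G₁ ++ l :: G₂)) : l.atom.DefinedIn P :=
  h l (by simp)

theorem Goal.DefinedIn.unfold {P : Program L} (hP : P.Closed) {G₁ G₂ : Goal L} {n : ℕ}
    {p : L.Relations n} {l : Literal L ℕ} (h : Goal.DefinedIn P (G₁ ++ l :: G₂))
    {d : PredDef L n} (hd : P.defn p = some d) {C : Conj L} (hC : C ∈ d.body)
    (η : ℕ → L.Term ℕ) : Goal.DefinedIn P (G₁ ++ C.map (Literal.subst η) ++ G₂) := by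
  rw [Goal.definedIn_append, Goal.definedIn_cons] at h
  rw [Goal.definedIn_append, Goal.definedIn_append]
  exact ⟨⟨h.1, Goal.DefinedIn.map_subst (hP n p d hd C hC) η⟩, h.2.2⟩

theorem Goal.definedIn_singleton_pos {P : Program L} {A : Atom L ℕ} (h : A.DefinedIn P) :
    Goal.DefinedIn P [.pos A] := by
  intro l hl
  rw [List.mem_singleton.1 hl]
  exact h

/-! ### Truth and falsity in models -/

namespace Interp

variable {I : Interp L} {P : Program L}

theorem conjTrue_append {C D : Conj L} {τ : ℕ → GroundTerm L} :
    I.ConjTrue (C ++ D) τ ↔ I.ConjTrue C τ ∧ I.ConjTrue D τ :=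
  List.forall_mem_append

theorem conjTrue_cons {l : Literal L ℕ} {D : Conj L} {τ : ℕ → GroundTerm L} :
    I.ConjTrue (l :: D) τ ↔ I.LitTrue (l.subst τ) ∧ I.ConjTrue D τ :=
  List.forall_mem_cons

theorem conjFalse_append {C D : Conj L} {τ : ℕ → GroundTerm L} :
    I.ConjFalse (C ++ D) τ ↔ I.ConjFalse C τ ∨ I.ConjFalse D τ := by
  simp only [ConjFalse, List.mem_append, or_and_right, exists_or]

theorem conjFalse_cons {l : Literal L ℕ} {D : Conj L} {τ : ℕ → GroundTerm L} :
    I.ConjFalse (l :: D) τ ↔ I.LitFalse (l.subst τ) ∨ I.ConjFalse D τ := by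
  simp only [ConjFalse, List.mem_cons, exists_eq_or_imp]

theorem conjTrue_map_subst {C : Conj L} {θ : ℕ → L.Term ℕ} {τ : ℕ → GroundTerm L} :
    I.ConjTrue (C.map (Literal.subst θ)) τ ↔ I.ConjTrue C (fun x => (θ x).subst τ) := by
  simp only [ConjTrue, List.forall_mem_map, Literal.subst_subst]

theorem conjFalse_map_subst {C : Conj L} {θ : ℕ → L.Term ℕ} {τ : ℕ → GroundTerm L} :
    I.ConjFalse (C.map (Literal.subst θ)) τ ↔ I.ConjFalse C (fun x => (θ x).subst τ) := by
  simp only [ConjFalse, List.mem_map, exists_exists_and_eq_and, Literal.subst_subst]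

/-- Needed because revaluing the fresh local variables changes a substitution only outside the
variables of the goal. -/
theorem ConjFalse.congr {C : Conj L} {σ τ : ℕ → GroundTerm L} (h : I.ConjFalse C σ)
    (hστ : ∀ x ∈ Goal.vars C, σ x = τ x) : I.ConjFalse C τ := by
  obtain ⟨l, hl, hf⟩ := h
  refine ⟨l, hl, ?_⟩
  rwa [← Literal.subst_congr fun x hx => hστ x ⟨l, hl, hx⟩]

/-- Going up in `⊑` never loses the truth bit; whether the body is also made false does not matter.
-/
theorem atomTrue_of_bodyTrue (hI : I.IsModel Truth4.InfoGE P) {n : ℕ} {p : L.Relations n}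
    {d : PredDef L n} (hd : P.defn p = some d) {args : Fin n → GroundTerm L}
    (h : I.BodyTrue d args) : I.AtomTrue (.rel p args) := by
  have hm := hI n p d hd args
  unfold Truth4.InfoGE Truth4.InfoLE bodyVal Truth4.ofProps at hm
  unfold AtomTrue
  by_cases hF : I.BodyFalse d args <;> simp only [h, hF, if_true, if_false] at hm <;>
    rcases hm with hm | hm | hm <;> simp_all [eq_comm]

theorem atomFalse_of_bodyFalse (hI : I.IsModel Truth4.InfoGE P) {n : ℕ} {p : L.Relations n}
    {d : PredDef L n} (hd : P.defn p = some d) {args : Fin n → GroundTerm L}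
    (h : I.BodyFalse d args) : I.AtomFalse (.rel p args) := by
  have hm := hI n p d hd args
  unfold Truth4.InfoGE Truth4.InfoLE bodyVal Truth4.ofProps at hm
  unfold AtomFalse
  by_cases hT : I.BodyTrue d args <;> simp only [h, hT, if_true, if_false] at hm <;>
    rcases hm with hm | hm | hm <;> simp_all [eq_comm]

/-- A ground instance of an equation that does not unify its two sides makes it false. -/
theorem litFalse_eq_of_ne {s t : L.Term ℕ} {τ : ℕ → GroundTerm L}
    (h : s.subst τ ≠ t.subst τ) : I.LitFalse ((Literal.pos (.eq s t)).subst τ) :=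
  Or.inl (I.val_eq_ne _ _ h)

end Interp

/-! ### Ground unifiers -/

/-- A ground substitution, read as a substitution over the variables. -/
def liftGround (τ : ℕ → GroundTerm L) : ℕ → L.Term ℕ := fun x => (τ x).subst (fun e => e.elim)

theorem liftGround_subst (τ σ : ℕ → GroundTerm L) (x : ℕ) : (liftGround τ x).subst σ = τ x := by
  rw [liftGround, subst_subst_term, subst_ground_term]

theorem unifies_liftGround {s t : L.Term ℕ} {τ : ℕ → GroundTerm L}
    (h : s.subst τ = t.subst τ) : Unifies (liftGround τ) s t := by
  have := congrArg (fun r : GroundTerm L => r.subst (fun e : Empty => (e.elim : L.Term ℕ))) h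
  simp only [subst_subst_term] at this
  exact this

theorem IsMGU.exists_ground {θ : ℕ → L.Term ℕ} {s t : L.Term ℕ} (hθ : IsMGU θ s t)
    {τ : ℕ → GroundTerm L} (h : s.subst τ = t.subst τ) :
    ∃ δ : ℕ → GroundTerm L, τ = fun x => (θ x).subst δ := by
  obtain ⟨δ, hδ⟩ := hθ.2 _ (unifies_liftGround h)
  -- The factor `δ` may leave variables. Any ground substitution removes them without affecting the
  -- values of `τ`, which are already ground; `τ` itself serves.
  refine ⟨fun x => (δ x).subst τ, funext fun x => ?_⟩
  rw [← subst_subst_term, ← hδ, liftGround_subst]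

/-- Ground instances of a goal and of the body of a definition are simultaneously instances of the
goal and of the head instance `η`, if they agree on the head. -/
theorem IsHeadInstance.exists_ground {G : Goal L} {n : ℕ} {d : PredDef L n}
    {args : Fin n → L.Term ℕ} {η : ℕ → L.Term ℕ} (hη : IsHeadInstance G d args η)
    (hargs : ∀ k, ∀ x ∈ (args k).varFinset, x ∈ G.vars) (τ σ : ℕ → GroundTerm L)
    (hσ : ∀ k, σ (d.headVar k) = (args k).subst τ) :
    ∃ δ : ℕ → GroundTerm L, (∀ x ∈ G.vars, δ x = τ x) ∧ (fun x => (η x).subst δ) = σ := by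
  classical
  obtain ⟨hhead, ρ, hρ, hlocal⟩ := hη
  -- Freshness of the renamed local variables keeps the two cases from conflicting, and injectivity
  -- of `ρ` lets `σ` be read back through its inverse.
  let δ : ℕ → GroundTerm L := fun y =>
    if y ∈ G.vars then τ y
    else σ (Function.invFunOn ρ (Set.range d.headVar)ᶜ y)
  have hδ : ∀ x ∈ G.vars, δ x = τ x := fun x hx => if_pos hx
  refine ⟨δ, hδ, funext fun x => ?_⟩
  by_cases hx : x ∈ Set.range d.headVar
  · obtain ⟨k, rfl⟩ := hx
    rw [hhead, hσ]
    exact subst_congr_term fun y hy => hδ y (hargs k y hy)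
  · obtain ⟨hfresh, hηx⟩ := hlocal x hx
    rw [hηx]
    change (if ρ x ∈ G.vars then _ else _) = _
    rw [if_neg hfresh, hρ.leftInvOn_invFunOn hx]

/-! ### Soundness of SLDNF resolution -/

section Soundness

variable {P : Program L} {I : Interp L}

/-- If `τ` falsifies nothing in `G₁` and `G₂`, each resolvent can only be false because of its body
part. Since the local variables take arbitrary values there, the whole existential body is false,
and hence so is the head. -/
theorem Interp.litFalse_rel_or_conjFalse (hI : I.IsModel Truth4.InfoGE P) {G₁ G₂ : Goal L}
    {n : ℕ} {p : L.Relations n} {args : Fin n → L.Term ℕ} {d : PredDef L n}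
    (hd : P.defn p = some d) {η : ℕ → L.Term ℕ}
    (hη : IsHeadInstance (G₁ ++ .pos (.rel p args) :: G₂) d args η)
    (h : ∀ C ∈ d.body, ∀ τ, I.ConjFalse (G₁ ++ C.map (Literal.subst η) ++ G₂) τ)
    (τ : ℕ → GroundTerm L) : I.ConjFalse (G₁ ++ .pos (.rel p args) :: G₂) τ := by
  rw [Interp.conjFalse_append, Interp.conjFalse_cons]
  by_contra! hcon
  obtain ⟨h₁, hA, h₂⟩ := hcon
  refine hA (Interp.atomFalse_of_bodyFalse hI hd fun σ hσ C hC => ?_)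
  have hargs : ∀ k, ∀ x ∈ (args k).varFinset,
      x ∈ Goal.vars (G₁ ++ .pos (.rel p args) :: G₂) := fun k x hx =>
    ⟨.pos (.rel p args), by simp, Set.mem_iUnion.2 ⟨k, hx⟩⟩
  obtain ⟨δ, hδ, hδσ⟩ := hη.exists_ground hargs τ σ hσ
  have hf := h C hC δ
  rw [Interp.conjFalse_append, Interp.conjFalse_append, Interp.conjFalse_map_subst, hδσ] at hf
  rcases hf with (hf | hf) | hf
  · refine (h₁ (hf.congr fun x hx => hδ x ?_)).elim
    obtain ⟨l, hl, hx⟩ := hx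
    exact ⟨l, by simp [hl], hx⟩
  · exact hf
  · refine (h₂ (hf.congr fun x hx => hδ x ?_)).elim
    obtain ⟨l, hl, hx⟩ := hx
    exact ⟨l, by simp [hl], hx⟩

mutual

/-- A model makes some ground instance of every refutable goal true. -/
theorem Refutable.exists_conjTrue [Nonempty L.Constants] (hP : P.Closed)
    (hI : I.IsModel Truth4.InfoGE P) {G : Goal L} (hG : Refutable P G) (hGP : G.DefinedIn P) :
    ∃ τ, I.ConjTrue G τ := by
  match hG with
  | .nil =>
    -- A constant is what guarantees that a ground substitution exists.
    exact ⟨fun _ => (Classical.arbitrary L.Constants).term, by simp [Interp.ConjTrue]⟩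
  | .eq G₁ G₂ s t θ hθ h =>
    obtain ⟨τ, hτ⟩ := Refutable.exists_conjTrue hP hI h (hGP.erase.map_subst θ)
    rw [Interp.conjTrue_map_subst, Interp.conjTrue_append] at hτ
    -- The witness is `θ` followed by `τ`.
    refine ⟨_, Interp.conjTrue_append.2 ⟨hτ.1, Interp.conjTrue_cons.2 ⟨Or.inl ?_, hτ.2⟩⟩⟩
    simp only [Atom.subst]
    rw [← subst_subst_term, ← subst_subst_term, hθ.1]
    exact I.val_eq_self _
  | .rel G₁ G₂ p args d hd C hC η hη h =>
    obtain ⟨τ, hτ⟩ := Refutable.exists_conjTrue hP hI h (hGP.unfold hP hd hC η)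
    rw [Interp.conjTrue_append, Interp.conjTrue_append, Interp.conjTrue_map_subst] at hτ
    refine ⟨τ, Interp.conjTrue_append.2 ⟨hτ.1.1, Interp.conjTrue_cons.2 ⟨?_, hτ.2⟩⟩⟩
    exact Interp.atomTrue_of_bodyTrue hI hd ⟨_, fun k => by rw [hη.1], C, hC, hτ.1.2⟩
  | .neg G₁ G₂ A hA hf h =>
    obtain ⟨τ, hτ⟩ := Refutable.exists_conjTrue hP hI h hGP.erase
    rw [Interp.conjTrue_append] at hτ
    refine ⟨τ, Interp.conjTrue_append.2 ⟨hτ.1, Interp.conjTrue_cons.2 ⟨?_, hτ.2⟩⟩⟩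
    obtain ⟨l, hl, hfl⟩ := FinitelyFailed.conjFalse hP hI hf
      (Goal.definedIn_singleton_pos hGP.selected) τ
    rw [List.mem_singleton.1 hl] at hfl
    exact hfl

/-- A model makes all ground instances of every finitely failed goal false. -/
theorem FinitelyFailed.conjFalse [Nonempty L.Constants] (hP : P.Closed)
    (hI : I.IsModel Truth4.InfoGE P) {G : Goal L} (hG : FinitelyFailed P G)
    (hGP : G.DefinedIn P) (τ : ℕ → GroundTerm L) : I.ConjFalse G τ := by
  match hG with
  | .eq_clash G₁ G₂ s t hst =>
    rw [Interp.conjFalse_append, Interp.conjFalse_cons]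
    exact Or.inr (Or.inl (Interp.litFalse_eq_of_ne fun h => hst ⟨_, unifies_liftGround h⟩))
  | .eq G₁ G₂ s t θ hθ h =>
    rw [Interp.conjFalse_append, Interp.conjFalse_cons]
    -- Either `τ` unifies the equation and so factors through the mgu, or the equation itself is
    -- false.
    by_cases hst : s.subst τ = t.subst τ
    · obtain ⟨δ, rfl⟩ := hθ.exists_ground hst
      have hf := FinitelyFailed.conjFalse hP hI h (hGP.erase.map_subst θ) δ
      rw [Interp.conjFalse_map_subst, Interp.conjFalse_append] at hf
      exact hf.imp_right Or.inr
    · exact Or.inr (Or.inl (Interp.litFalse_eq_of_ne hst))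
  | .rel_undefined G₁ G₂ p args hd =>
    -- A model does not constrain undefined predicates, so this case must be impossible.
    have hdef : (P.defn p).isSome := hGP.selected
    simp [hd] at hdef
  | .rel G₁ G₂ p args d hd η hη h =>
    exact Interp.litFalse_rel_or_conjFalse hI hd hη (fun C hC σ =>
      FinitelyFailed.conjFalse hP hI (h C hC) (hGP.unfold hP hd hC η) σ) τ
  | .neg_refuted G₁ G₂ A hA hs =>
    obtain ⟨σ, hσ⟩ := Refutable.exists_conjTrue hP hI hs
      (Goal.definedIn_singleton_pos hGP.selected)
    rw [Interp.conjFalse_append, Interp.conjFalse_cons]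
    have hAσ : I.AtomTrue (A.subst σ) := (Interp.conjTrue_cons.1 hσ).1
    -- As `A` is ground, truth at the one witness `σ` is truth at every `τ`.
    rw [Atom.subst_congr (δ := τ) (by simp [hA])] at hAσ
    exact Or.inr (Or.inl hAσ)
  | .neg G₁ G₂ A hA hf h =>
    have hf := FinitelyFailed.conjFalse hP hI h hGP.erase τ
    rw [Interp.conjFalse_append] at hf
    rw [Interp.conjFalse_append, Interp.conjFalse_cons]
    exact hf.imp_right Or.inr

end

theorem Succeeds.atomTrue [Nonempty L.Constants] (hP : P.Closed)
    (hI : I.IsModel Truth4.InfoGE P) {A : GroundAtom L} (hA : A.DefinedIn P)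
    (h : Succeeds P A) : I.AtomTrue A := by
  obtain ⟨τ, hτ⟩ := Refutable.exists_conjTrue hP hI h (Goal.definedIn_singleton_pos (hA.subst _))
  have hAτ : I.AtomTrue (A.ofGround.subst τ) := (Interp.conjTrue_cons.1 hτ).1
  rwa [Atom.ofGround_subst] at hAτ

theorem FinitelyFails.atomFalse [Nonempty L.Constants] (hP : P.Closed)
    (hI : I.IsModel Truth4.InfoGE P) {A : GroundAtom L} (hA : A.DefinedIn P)
    (h : FinitelyFails P A) : I.AtomFalse A := by
  obtain ⟨l, hl, hf⟩ := FinitelyFailed.conjFalse hP hI h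
    (Goal.definedIn_singleton_pos (hA.subst _)) fun _ => (Classical.arbitrary L.Constants).term
  rw [List.mem_singleton.1 hl] at hf
  change I.AtomFalse (A.ofGround.subst _) at hf
  rwa [Atom.ofGround_subst] at hf

end Soundness

end FourLP

theorem mainTheorem2 {L : FirstOrder.Language} [Nonempty L.Constants]
    (P : FourLP.Program L) (hP : P.Closed)
    (I : FourLP.Interp L) (hI : I.IsModel FourLP.Truth4.InfoGE P)
    (A : FourLP.GroundAtom L) (hA : A.DefinedIn P) :
    (I.val A = .t → ¬ FourLP.FinitelyFails P A) ∧
    (I.val A = .f → ¬ FourLP.Succeeds P A) ∧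
    (I.val A = .u → ¬ FourLP.Succeeds P A ∧ ¬ FourLP.FinitelyFails P A) := by
  have hT : FourLP.Succeeds P A → I.val A = .t ∨ I.val A = .i :=
    FourLP.Succeeds.atomTrue hP hI hA
  have hF : FourLP.FinitelyFails P A → I.val A = .f ∨ I.val A = .i :=
    FourLP.FinitelyFails.atomFalse hP hI hA
  refine ⟨fun h hf => ?_, fun h hs => ?_, fun h => ⟨fun hs => ?_, fun hf => ?_⟩⟩
  · simpa [h] using hF hf
  · simpa [h] using hT hs
  · simpa [h] using hT hs
  · simpa [h] using hF hf
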